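/- Let $q$ be a prime power, let $F=\mathbb{F}_q$, and let $n\ge 3$. Let $\mathcal{Q}_n$ (respectively $\mathcal{L}_n$) be the space of homogeneous polynomials of degree $2$ (respectively $1$) in $x_1,\dots,x_n$ over $F$. The weight $\operatorname{wt}(Q)$ of $Q\in\mathcal{Q}_n$ is the smallest integer $k\ge 0$ such that $Q=\ell_1\ell_1'+\dots+\ell_k\ell_k'$ for some $\ell_i,\ell_i'\in\mathcal{L}_n$ (so $\operatorname{wt}(0)=0$). Let $\mathcal{C}\subset\mathcal{Q}_n$ be a set such that $\operatorname{wt}(Q-Q')\ge 3$ for all distinct $Q,Q'\in\mathcal{C}$. Then $$|\mathcal{C}|<q^{(n-1)(n-2)/2}.$$ -/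

import Mathlib

/-- The space `𝒬ₙ` of quadratic forms: homogeneous polynomials of degree `2` in `x₁, …, xₙ`. -/
abbrev QuadForms (n : ℕ) (F : Type*) [Field F] : Submodule F (MvPolynomial (Fin n) F) :=
  MvPolynomial.homogeneousSubmodule (Fin n) F 2

/-- The space `ℒₙ` of linear forms: homogeneous polynomials of degree `1` in `x₁, …, xₙ`. -/
abbrev LinForms (n : ℕ) (F : Type*) [Field F] : Submodule F (MvPolynomial (Fin n) F) :=
  MvPolynomial.homogeneousSubmodule (Fin n) F 1

/-- `P` can be expressed as a sum of `k` products of two linear forms. -/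
def IsSumOfProducts {n : ℕ} {F : Type*} [Field F] (P : MvPolynomial (Fin n) F) (k : ℕ) : Prop :=
  ∃ l l' : Fin k → LinForms n F,
    P = ∑ i, (l i : MvPolynomial (Fin n) F) * (l' i : MvPolynomial (Fin n) F)

theorem IsSumOfProducts.add {n : ℕ} {F : Type*} [Field F] {P P' : MvPolynomial (Fin n) F}
    {k k' : ℕ} (h : IsSumOfProducts P k) (h' : IsSumOfProducts P' k') :
    IsSumOfProducts (P + P') (k + k') := by
  obtain ⟨a, b, rfl⟩ := h
  obtain ⟨c, d, rfl⟩ := h'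
  refine ⟨Fin.append a c, Fin.append b d, ?_⟩
  simp [Fin.sum_univ_add]

/-- Every quadratic form is a sum of finitely many products of linear forms,
so the minimum that defines the weight is attained. -/
theorem exists_isSumOfProducts {n : ℕ} {F : Type*} [Field F] (Q : QuadForms n F) :
    ∃ k, IsSumOfProducts (Q : MvPolynomial (Fin n) F) k := by
  obtain ⟨Q, hQ⟩ := Q
  have h2 : QuadForms n F = LinForms n F ^ 2 :=
    (MvPolynomial.homogeneousSubmodule_one_pow (σ := Fin n) (R := F) 2).symm
  rw [h2, pow_two] at hQ
  refine Submodule.mul_induction_on (C := fun P => ∃ k, IsSumOfProducts P k) hQ ?_ ?_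
  · intro a ha b hb
    exact ⟨1, fun _ => ⟨a, ha⟩, fun _ => ⟨b, hb⟩, by simp⟩
  · rintro P P' ⟨k, h⟩ ⟨k', h'⟩
    exact ⟨k + k', h.add h'⟩

/-- The weight of a quadratic form: the least `k` such that it is a sum of `k` products of
two linear forms. The zero form has weight `0`. -/
noncomputable def formWeight {n : ℕ} {F : Type*} [Field F] (Q : QuadForms n F) : ℕ :=
  sInf {k | IsSumOfProducts (Q : MvPolynomial (Fin n) F) k}

/-- The minimum weight of a set of quadratic forms: the least weight of the difference of two
distinct elements (`⊤` if there are no two distinct elements). -/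
noncomputable def minWeight {n : ℕ} {F : Type*} [Field F] (C : Set (QuadForms n F)) : ℕ∞ :=
  ⨅ (Q ∈ C) (Q' ∈ C) (_ : Q ≠ Q'), (formWeight (Q - Q') : ℕ∞)

/-! A form that vanishes on a subspace of codimension k has weight at most k. So a nonzero
difference of code elements never vanishes in codimension 2, and restriction to a subspace of
codimension 2 is injective on the code. This gives |C| ≤ q^((n-1)(n-2)/2). Under equality every such
restriction is a bijection onto all forms on the subspace. Then any combination of functions that
read a form only on subspaces of dimension at most n - 2 has the same average over differences of
code elements as over all forms (`design`). For n ≥ 4 this is refuted by a suitable test function;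
for n = 3 the code has at most one element.

The test functions are polynomials of degree at most n - 2 in the bias, which is an average of point
evaluations. With r = 1/q, the bias is 0, r^s or -r^s, and the last two force vanishing in
codimension s and s + 1 (`biasClassified`). Nonzero differences thus have bias 0, r^s with s ≥ 3, or
-r^s with s ≥ 2. For odd n a polynomial of degree n - 2 kills these values and also 1, yet is
nonnegative on all forms and positive on one.

For even n the same polynomial would have degree n - 1. Instead the bias is compared with r times
the bias on a hyperplane: given the restriction, the discrepancy averages to zero over all forms
(`sum_mul_bias_sub`), and it vanishes on differences in the one case that the polynomial factor
misses (`bias_eq_of_hyperplane`). -/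

open Module

/-! ### The bias of a quadratic form and its behaviour under restriction -/

section

namespace FormCode

variable {F V : Type*} [Field F] [AddCommGroup V] [Module F V]

/-- The form vanishes on a subspace of codimension at most `k`. -/
def VanishesInCodim (Q : QuadraticForm F V) (k : ℕ) : Prop :=
  ∃ U : Submodule F V, finrank F V ≤ finrank F U + k ∧ ∀ u ∈ U, Q u = 0

theorem VanishesInCodim.mono {Q : QuadraticForm F V} {k l : ℕ} (h : VanishesInCodim Q k)
    (hkl : k ≤ l) : VanishesInCodim Q l := by
  obtain ⟨U, h1, h2⟩ := h
  exact ⟨U, by omega, h2⟩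

theorem apply_add_smul (Q : QuadraticForm F V) {k : V} (hk : Q k = 0) (v : V) (t : F) :
    Q (v + t • k) = Q v + t * QuadraticMap.polar Q k v := by
  rw [QuadraticMap.map_add Q v (t • k), QuadraticMap.map_smul, hk, QuadraticMap.polar_smul_right,
    QuadraticMap.polar_comm]
  simp

open Classical in
theorem sum_eq_sum_submodule_add [Fintype V] (H : Submodule F V) [Fintype H] (g : V → ℚ) :
    ∑ v, g v = ∑ v : H, g v + ∑ v, if v ∈ H then 0 else g v := by
  have h1 : ∑ v : H, g v = ∑ v, if v ∈ H then g v else 0 := by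
    rw [← Finset.sum_filter]
    exact (Finset.sum_subtype _ (by simp) _).symm
  rw [h1, ← Finset.sum_add_distrib]
  exact Finset.sum_congr rfl (fun v _ => by split_ifs <;> simp)

theorem apply_add_of_radical (Q : QuadraticForm F V) {K : Submodule F V} (hK : ∀ k ∈ K, Q k = 0)
    (hp : ∀ k ∈ K, ∀ v, QuadraticMap.polar Q k v = 0) {k : V} (hk : k ∈ K) (v : V) :
    Q (k + v) = Q v := by
  rw [QuadraticMap.map_add Q k v, hK k hk, hp k hk v]
  simp

variable [Fintype F]

open Classical in
/-- The function on `F` that is `1` at zero, constant elsewhere, and sums to zero. -/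
noncomputable def zeroWeight (t : F) : ℚ := if t = 0 then 1 else -1 / (Fintype.card F - 1)

theorem one_lt_card_rat : (1 : ℚ) < Fintype.card F := by
  exact_mod_cast Fintype.one_lt_card (α := F)

theorem sum_zeroWeight : ∑ t : F, zeroWeight t = 0 := by
  classical
  have h := one_lt_card_rat (F := F)
  have h1 : (Fintype.card F : ℚ) - 1 ≠ 0 := by linarith
  rw [← Finset.add_sum_erase _ _ (Finset.mem_univ (0 : F))]
  have : ∀ t ∈ Finset.univ.erase (0 : F), zeroWeight t = -1 / (Fintype.card F - 1 : ℚ) := by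
    intro t ht
    simp [zeroWeight, Finset.ne_of_mem_erase ht]
  rw [Finset.sum_congr rfl this, Finset.sum_const, Finset.card_erase_of_mem (Finset.mem_univ _),
    Finset.card_univ, nsmul_eq_mul, Nat.cast_sub Fintype.card_pos]
  simp only [zeroWeight, if_true, Nat.cast_one]
  field_simp
  ring

theorem sum_zeroWeight_affine (a : F) {b : F} (hb : b ≠ 0) :
    ∑ t : F, zeroWeight (a + t * b) = 0 := by
  rw [← sum_zeroWeight (F := F)]
  exact Fintype.sum_equiv ((Equiv.mulRight₀ b hb).trans (Equiv.addLeft a)) _ _ (fun t => by simp)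

/-- The normalized excess of zeros of a quadratic form. -/
noncomputable def bias (Q : QuadraticForm F V) : ℚ :=
  (∑ᶠ v, zeroWeight (Q v)) / Nat.card V

theorem bias_eq [Fintype V] (Q : QuadraticForm F V) :
    bias Q = (∑ v, zeroWeight (Q v)) / Fintype.card V := by
  rw [bias, finsum_eq_sum_of_fintype, Nat.card_eq_fintype_card]

theorem bias_eq_of_forall_eq_zero [Finite V] {Q : QuadraticForm F V} (h : ∀ v, Q v = 0) :
    bias Q = 1 := by
  have := Fintype.ofFinite V
  rw [bias_eq]
  simp [h, zeroWeight]

theorem sum_eq_zero_of_sum_translates [Fintype V] (g : V → ℚ) (k : V)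
    (h : ∀ v, ∑ t : F, g (v + t • k) = 0) : ∑ v, g v = 0 := by
  have h1 : ∑ t : F, ∑ v, g (v + t • k) = Fintype.card F * ∑ v, g v := by
    have : ∀ t : F, ∑ v, g (v + t • k) = ∑ v, g v := fun t =>
      Fintype.sum_equiv (Equiv.addRight (t • k)) _ _ (fun v => rfl)
    simp [this]
  rw [Finset.sum_comm, Finset.sum_congr rfl (fun v _ => h v)] at h1
  have := one_lt_card_rat (F := F)
  simp only [Finset.sum_const_zero, zero_eq_mul] at h1
  rcases h1 with h1 | h1
  · linarith
  · exact h1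

open Classical in
-- Translation by multiples of k preserves H. Off H it moves Q affinely with nonzero slope, so Q
-- takes each value once along every translate of the line and the weights cancel.
theorem sum_off_polar_eq_zero [Fintype V] (Q : QuadraticForm F V) (H : Submodule F V) (k : V)
    (hk : Q k = 0) (hH : ∀ v, v ∈ H ↔ QuadraticMap.polar Q k v = 0) :
    (∑ v, if v ∈ H then 0 else zeroWeight (Q v)) = 0 := by
  have hkH : k ∈ H := by rw [hH, QuadraticMap.polar_self, hk, smul_zero]
  refine sum_eq_zero_of_sum_translates (F := F) _ k (fun v => ?_)
  have : ∀ t : F, v + t • k ∈ H ↔ v ∈ H := fun t => H.add_mem_iff_left (H.smul_mem t hkH)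
  simp only [this]
  by_cases hv : v ∈ H
  · simp [hv]
  · simp only [hv, if_false, apply_add_smul Q hk]
    exact sum_zeroWeight_affine _ (fun h => hv ((hH v).2 h))

open Classical in
theorem bias_eq_restrict_add [Fintype V] (Q : QuadraticForm F V) (H : Submodule F V)
    (hH : finrank F H + 1 = finrank F V) :
    bias Q = (Fintype.card F : ℚ)⁻¹ * bias (Q.comp H.subtype) +
      (∑ v, if v ∈ H then 0 else zeroWeight (Q v)) / Fintype.card V := by
  have := Fintype.ofFinite H
  have hc : (Fintype.card V : ℚ) = Fintype.card F * Fintype.card H := by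
    rw [card_eq_pow_finrank (K := F) (V := V), card_eq_pow_finrank (K := F) (V := H), ← hH]
    push_cast
    ring
  have hF := one_lt_card_rat (F := F)
  have hF0 : (Fintype.card F : ℚ) ≠ 0 := by linarith
  have hV : (Fintype.card H : ℚ) ≠ 0 := by exact_mod_cast Fintype.card_ne_zero
  rw [bias_eq, bias_eq, sum_eq_sum_submodule_add H, hc]
  simp only [QuadraticMap.comp_apply, Submodule.subtype_apply]
  field_simp

theorem bias_eq_restrict_of_polar [Finite V] (Q : QuadraticForm F V) (H : Submodule F V)
    (hr : finrank F H + 1 = finrank F V) (k : V)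
    (hk : Q k = 0) (hH : ∀ v, v ∈ H ↔ QuadraticMap.polar Q k v = 0) :
    bias Q = (Fintype.card F : ℚ)⁻¹ * bias (Q.comp H.subtype) := by
  have := Fintype.ofFinite V
  rw [bias_eq_restrict_add Q H hr, sum_off_polar_eq_zero Q H k hk hH]
  simp

theorem bias_eq_restrict_of_isCompl [Finite V] (Q : QuadraticForm F V) (K W : Submodule F V)
    (h : IsCompl K W) (hK : ∀ k ∈ K, Q k = 0) (hp : ∀ k ∈ K, ∀ v, QuadraticMap.polar Q k v = 0) :
    bias Q = bias (Q.comp W.subtype) := by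
  have := Fintype.ofFinite V
  have := Fintype.ofFinite K
  have := Fintype.ofFinite W
  let e := (Submodule.prodEquivOfIsCompl K W h).toEquiv
  have hc : Fintype.card V = Fintype.card K * Fintype.card W := by
    rw [← Fintype.card_prod]
    exact (Fintype.card_congr e).symm
  have hs : ∑ v, zeroWeight (Q v) = ∑ x : K × W, zeroWeight (Q (x.1 + x.2 : V)) :=
    (Fintype.sum_equiv e _ _ (fun x => by simp [e])).symm
  have hK0 : (Fintype.card K : ℚ) ≠ 0 := by exact_mod_cast Fintype.card_ne_zero
  rw [bias_eq, bias_eq, hs, hc, Fintype.sum_prod_type]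
  simp only [apply_add_of_radical Q hK hp (Subtype.prop _), Finset.sum_const, Finset.card_univ,
    nsmul_eq_mul, QuadraticMap.comp_apply, Submodule.subtype_apply]
  push_cast
  rw [mul_div_mul_left _ _ hK0]

/-- Over a finite field an anisotropic quadratic form has at most two variables. -/
theorem finrank_le_two_of_anisotropic [Finite V] (Q : QuadraticForm F V) (hQ : Q.Anisotropic) :
    finrank F V ≤ 2 := by
  classical
  by_contra! hlt
  let b := finBasis F V
  let P : MvPolynomial (Fin (finrank F V)) F :=
    ∑ i, ∑ j, MvPolynomial.C (Q.toBilin b (b i) (b j)) * (MvPolynomial.X i * MvPolynomial.X j)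
  have hP : P.totalDegree < Fintype.card (Fin (finrank F V)) := by
    refine lt_of_le_of_lt ?_ (by simpa using hlt)
    refine MvPolynomial.totalDegree_finsetSum_le (fun i _ =>
      MvPolynomial.totalDegree_finsetSum_le (fun j _ => ?_))
    refine (MvPolynomial.totalDegree_mul _ _).trans ?_
    rw [MvPolynomial.totalDegree_C, zero_add]
    exact (MvPolynomial.totalDegree_mul _ _).trans (by simp)
  have hev : ∀ x : Fin (finrank F V) → F, MvPolynomial.eval x P = Q (∑ i, x i • b i) := by
    intro x
    conv_rhs => rw [← QuadraticMap.toQuadraticMap_toBilin Q b]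
    simp only [P, map_sum, map_mul, MvPolynomial.eval_C, MvPolynomial.eval_X,
      LinearMap.BilinMap.toQuadraticMap_apply, map_smul, LinearMap.sum_apply,
      LinearMap.smul_apply, smul_eq_mul, Finset.mul_sum]
    rw [Finset.sum_comm]
    refine Finset.sum_congr rfl fun i _ => Finset.sum_congr rfl fun j _ => by ring
  obtain ⟨p, hp⟩ := CharP.exists F
  -- Chevalley–Warning: the characteristic divides the number of zeros, while anisotropy leaves only
  -- the origin.
  have hdvd := char_dvd_card_solutions p hP
  have hone : Fintype.card {x : Fin (finrank F V) → F // MvPolynomial.eval x P = 0} = 1 := by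
    rw [Fintype.card_eq_one_iff]
    refine ⟨⟨0, by rw [hev]; simp⟩, fun ⟨x, hx⟩ => Subtype.ext ?_⟩
    rw [hev] at hx
    have h0 := hQ _ hx
    funext i
    exact Fintype.linearIndependent_iff.1 b.linearIndependent x h0 i
  rw [hone] at hdvd
  have := CharP.char_is_prime F p
  exact this.one_lt.ne' (Nat.dvd_one.1 hdvd)

end FormCode

end

/-! ### Values of the bias and the singular subspaces they force -/

section

namespace FormCode

universe u

variable {F : Type*} {V : Type u} [Field F] [AddCommGroup V] [Module F V]

theorem VanishesInCodim.of_radical_compl [FiniteDimensional F V] {Q : QuadraticForm F V}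
    {K W : Submodule F V} (h : IsCompl K W) (hK : ∀ k ∈ K, Q k = 0)
    (hp : ∀ k ∈ K, ∀ v, QuadraticMap.polar Q k v = 0) {c : ℕ}
    (hW : VanishesInCodim (Q.comp W.subtype) c) : VanishesInCodim Q c := by
  obtain ⟨U, h1, h2⟩ := hW
  refine ⟨K ⊔ U.map W.subtype, ?_, ?_⟩
  · have hd : Disjoint K (U.map W.subtype) := h.disjoint.mono_right (Submodule.map_subtype_le W U)
    have e1 := Submodule.finrank_sup_add_finrank_inf_eq K (U.map W.subtype)
    rw [hd.eq_bot, finrank_bot, Submodule.finrank_map_subtype_eq] at e1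
    have e2 := Submodule.finrank_add_eq_of_isCompl h
    omega
  · intro u hu
    obtain ⟨k, hk, w, hw, rfl⟩ := Submodule.mem_sup.1 hu
    obtain ⟨w, hw, rfl⟩ := hw
    rw [apply_add_of_radical Q hK hp hk]
    exact h2 w hw

theorem VanishesInCodim.of_submodule [FiniteDimensional F V] {Q : QuadraticForm F V}
    {H : Submodule F V} {c d : ℕ} (hr : finrank F V ≤ finrank F H + d)
    (hH : VanishesInCodim (Q.comp H.subtype) c) : VanishesInCodim Q (c + d) := by
  obtain ⟨U, h1, h2⟩ := hH
  refine ⟨U.map H.subtype, ?_, ?_⟩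
  · rw [Submodule.finrank_map_subtype_eq]
    omega
  · rintro _ ⟨w, hw, rfl⟩
    exact h2 w hw

theorem span_singleton_radical {Q : QuadraticForm F V} {v : V} (hv : Q v = 0)
    (hp : ∀ w, QuadraticMap.polar Q v w = 0) :
    (∀ k ∈ F ∙ v, Q k = 0) ∧ ∀ k ∈ F ∙ v, ∀ w, QuadraticMap.polar Q k w = 0 := by
  constructor
  · intro k hk
    obtain ⟨a, rfl⟩ := Submodule.mem_span_singleton.1 hk
    rw [QuadraticMap.map_smul, hv, smul_zero]
  · intro k hk w
    obtain ⟨a, rfl⟩ := Submodule.mem_span_singleton.1 hk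
    rw [QuadraticMap.polar_smul_left, hp, smul_zero]

theorem finrank_ker_polar [FiniteDimensional F V] {Q : QuadraticForm F V} {v w : V}
    (h : QuadraticMap.polar Q v w ≠ 0) :
    finrank F (LinearMap.ker (QuadraticMap.polarBilin Q v)) + 1 = finrank F V := by
  refine Dual.finrank_ker_add_one_of_ne_zero (f := QuadraticMap.polarBilin Q v) ?_
  intro h0
  exact h (by rw [← QuadraticMap.polarBilin_apply_apply, h0]; rfl)

variable [Fintype F]

/-- The possible values of the bias of a quadratic form, with the size of a singular subspace
that each value forces. -/
def BiasClassified (Q : QuadraticForm F V) : Prop :=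
  bias Q = 0 ∨ ∃ s, 2 * s ≤ finrank F V ∧
    ((bias Q = (Fintype.card F : ℚ)⁻¹ ^ s ∧ VanishesInCodim Q s) ∨
      (1 ≤ s ∧ bias Q = -(Fintype.card F : ℚ)⁻¹ ^ s ∧ VanishesInCodim Q (s + 1)))

/-- The dimension is at most 2 and the origin is the only zero. Counting gives bias 1, 0, -1/q in
dimensions 0, 1, 2. -/
theorem biasClassified_of_anisotropic [Finite V] {Q : QuadraticForm F V} (hQ : Q.Anisotropic) :
    BiasClassified Q := by
  classical
  have := Fintype.ofFinite V
  have hF := one_lt_card_rat (F := F)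
  have hle := finrank_le_two_of_anisotropic Q hQ
  have hs : ∑ v, zeroWeight (Q v) = 1 - ((Fintype.card F : ℚ) ^ finrank F V - 1) /
      (Fintype.card F - 1) := by
    rw [← Finset.add_sum_erase _ _ (Finset.mem_univ (0 : V))]
    have : ∀ t ∈ Finset.univ.erase (0 : V), zeroWeight (Q t) = -1 / (Fintype.card F - 1 : ℚ) := by
      intro t ht
      have : Q t ≠ 0 := fun h => Finset.ne_of_mem_erase ht (hQ t h)
      simp [zeroWeight, this]
    rw [Finset.sum_congr rfl this, Finset.sum_const, Finset.card_erase_of_mem (Finset.mem_univ _),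
      Finset.card_univ, nsmul_eq_mul, Nat.cast_sub Fintype.card_pos,
      card_eq_pow_finrank (K := F) (V := V)]
    simp only [zeroWeight, map_zero, if_true, Nat.cast_one]
    push_cast
    ring
  have hb : bias Q = (1 - ((Fintype.card F : ℚ) ^ finrank F V - 1) /
      (Fintype.card F - 1)) / (Fintype.card F : ℚ) ^ finrank F V := by
    rw [bias_eq, hs, card_eq_pow_finrank (K := F) (V := V)]
    push_cast
    rfl
  have h1 : (Fintype.card F : ℚ) - 1 ≠ 0 := by linarith
  have h0 : (Fintype.card F : ℚ) ≠ 0 := by linarith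
  have hbot : ∀ k, finrank F V ≤ k → VanishesInCodim Q k := fun k hk =>
    ⟨⊥, by omega, fun u hu => by rw [(Submodule.mem_bot F).1 hu, map_zero]⟩
  interval_cases h : finrank F V
  · refine Or.inr ⟨0, by omega, Or.inl ⟨by simp [hb], hbot 0 le_rfl⟩⟩
  · left
    rw [hb, pow_one, div_self h1]
    simp
  · refine Or.inr ⟨1, by omega, Or.inr ⟨le_rfl, ?_, hbot 2 le_rfl⟩⟩
    rw [hb]
    field_simp
    ring

theorem biasClassified_of_radical [Finite V] {Q : QuadraticForm F V} {K W : Submodule F V}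
    (h : IsCompl K W) (hK : ∀ k ∈ K, Q k = 0)
    (hp : ∀ k ∈ K, ∀ v, QuadraticMap.polar Q k v = 0)
    (hW : BiasClassified (Q.comp W.subtype)) : BiasClassified Q := by
  rw [BiasClassified, bias_eq_restrict_of_isCompl Q K W h hK hp]
  have hle := W.finrank_le
  refine hW.imp_right ?_
  rintro ⟨s, hs, h1 | h1⟩
  · exact ⟨s, by omega, Or.inl ⟨h1.1, h1.2.of_radical_compl h hK hp⟩⟩
  · exact ⟨s, by omega, Or.inr ⟨h1.1, h1.2.1, h1.2.2.of_radical_compl h hK hp⟩⟩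

/-- A singular vector v either lies in the radical and splits off, or its polar kernel is a
hyperplane. In the second case passing to the hyperplane costs a factor 1/q; there v is radical, and
induction applies to a complement of dimension n - 2. Both s and the codimension rise by one. -/
theorem biasClassified_of_finrank_eq (n : ℕ) : ∀ (V : Type u) [AddCommGroup V] [Module F V] [Finite V]
    (Q : QuadraticForm F V), finrank F V = n → BiasClassified Q := by
  induction n using Nat.strong_induction_on with
  | _ n ih =>
  intro V _ _ _ Q hn
  by_cases hQ : Q.Anisotropic
  · exact biasClassified_of_anisotropic hQ
  obtain ⟨v, hv0, hv⟩ := Q.not_anisotropic_iff_exists.1 hQ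
  by_cases hp : ∀ w, QuadraticMap.polar Q v w = 0
  · obtain ⟨W, hW⟩ := exists_isCompl (F ∙ v)
    obtain ⟨h1, h2⟩ := span_singleton_radical hv hp
    have e := Submodule.finrank_add_eq_of_isCompl hW
    rw [finrank_span_singleton hv0] at e
    exact biasClassified_of_radical hW h1 h2 (ih _ (by omega) W _ rfl)
  · push Not at hp
    obtain ⟨w, hw⟩ := hp
    have hr := finrank_ker_polar hw
    set H := LinearMap.ker (QuadraticMap.polarBilin Q v) with hH
    have hmem : ∀ x, x ∈ H ↔ QuadraticMap.polar Q v x = 0 := fun x => by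
      rw [hH, LinearMap.mem_ker, QuadraticMap.polarBilin_apply_apply]
    have hvH : v ∈ H := by rw [hmem, QuadraticMap.polar_self, hv, smul_zero]
    let v' : H := ⟨v, hvH⟩
    have hv' : (Q.comp H.subtype) v' = 0 := hv
    have hp' : ∀ x, QuadraticMap.polar (Q.comp H.subtype) v' x = 0 := fun x => (hmem x).1 x.2
    obtain ⟨W, hW⟩ := exists_isCompl (F ∙ v')
    obtain ⟨h1, h2⟩ := span_singleton_radical hv' hp'
    have e := Submodule.finrank_add_eq_of_isCompl hW
    rw [finrank_span_singleton (fun h => hv0 (congrArg Subtype.val h))] at e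
    have hb := bias_eq_restrict_of_polar Q H hr v hv hmem
    rw [bias_eq_restrict_of_isCompl _ _ W hW h1 h2] at hb
    rw [BiasClassified, hb]
    rcases ih _ (by omega) W ((Q.comp H.subtype).comp W.subtype) rfl with h0 | ⟨s, hs, h | h⟩
    · left
      rw [h0, mul_zero]
    · refine Or.inr ⟨s + 1, by omega, Or.inl ⟨by rw [h.1, pow_succ'], ?_⟩⟩
      exact (h.2.of_radical_compl hW h1 h2).of_submodule hr.ge
    · refine Or.inr ⟨s + 1, by omega, Or.inr ⟨by omega, by rw [h.2.1, pow_succ', mul_neg], ?_⟩⟩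
      exact (h.2.2.of_radical_compl hW h1 h2).of_submodule hr.ge

theorem biasClassified [Finite V] (Q : QuadraticForm F V) : BiasClassified Q :=
  biasClassified_of_finrank_eq _ V Q rfl

theorem vanishesInCodim_two_of_finrank_le [Finite V] (Q : QuadraticForm F V)
    (h : finrank F V ≤ 3) : VanishesInCodim Q 2 := by
  by_cases hQ : Q.Anisotropic
  · have hle := finrank_le_two_of_anisotropic Q hQ
    exact ⟨⊥, by omega, fun u hu => by rw [(Submodule.mem_bot F).1 hu, map_zero]⟩
  · obtain ⟨v, hv0, hv⟩ := Q.not_anisotropic_iff_exists.1 hQ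
    refine ⟨F ∙ v, by rw [finrank_span_singleton hv0]; omega, fun k hk => ?_⟩
    obtain ⟨a, rfl⟩ := Submodule.mem_span_singleton.1 hk
    rw [QuadraticMap.map_smul, hv, smul_zero]

theorem inv_card_pos : 0 < (Fintype.card F : ℚ)⁻¹ :=
  inv_pos.2 (by linarith [one_lt_card_rat (F := F)])

theorem inv_card_lt_one : (Fintype.card F : ℚ)⁻¹ < 1 :=
  inv_lt_one_of_one_lt₀ one_lt_card_rat

open Classical in
theorem card_zeros_of_bias [Fintype V] {Q : QuadraticForm F V}
    (h : bias Q = -(Fintype.card F : ℚ)⁻¹) :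
    ((Finset.univ.filter (fun v => Q v = 0)).card : ℚ) * (Fintype.card F : ℚ) ^ 2 =
      Fintype.card V := by
  have hF := one_lt_card_rat (F := F)
  have h1 : (Fintype.card F : ℚ) - 1 ≠ 0 := by linarith
  have h0 : (Fintype.card F : ℚ) ≠ 0 := by linarith
  have hV : (Fintype.card V : ℚ) ≠ 0 := by exact_mod_cast Fintype.card_ne_zero
  rw [bias_eq] at h
  have hs : ∑ v, zeroWeight (Q v) = ((Finset.univ.filter (fun v => Q v = 0)).card : ℚ) *
      (1 + 1 / (Fintype.card F - 1)) - Fintype.card V / (Fintype.card F - 1) := by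
    have : ∀ v, zeroWeight (Q v) = (if Q v = 0 then 1 else 0) * (1 + 1 / (Fintype.card F - 1 : ℚ))
        - 1 / (Fintype.card F - 1 : ℚ) := fun v => by
      unfold zeroWeight
      split_ifs <;> ring
    rw [Finset.sum_congr rfl (fun v _ => this v), Finset.sum_sub_distrib, ← Finset.sum_mul,
      Finset.sum_boole, Finset.sum_const, Finset.card_univ, nsmul_eq_mul, mul_one_div]
  rw [hs] at h
  field_simp at h
  linear_combination h

/-- The zeros of Q on H form a subspace U, polar-orthogonal to H. If U were radical for Q on all of
V, then Q would reduce to a space of dimension at most 3 and vanish in codimension 2. So some x in U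
has polar kernel exactly H, and the vectors off H contribute nothing to the bias. -/
theorem bias_eq_of_hyperplane [Finite V] {Q : QuadraticForm F V} {H : Submodule F V}
    (hr : finrank F H + 1 = finrank F V)
    (hb : bias (Q.comp H.subtype) = -(Fintype.card F : ℚ)⁻¹) (hQ : ¬ VanishesInCodim Q 2) :
    bias Q = (Fintype.card F : ℚ)⁻¹ * bias (Q.comp H.subtype) := by
  classical
  have := Fintype.ofFinite H
  have hpos := inv_card_pos (F := F)
  have hlt := inv_card_lt_one (F := F)
  have hF := one_lt_card_rat (F := F)
  obtain ⟨U, hU, hU0⟩ : VanishesInCodim (Q.comp H.subtype) 2 := by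
    rcases biasClassified (Q.comp H.subtype) with h | ⟨s, hs, h | h⟩
    · linarith
    · have := h.1 ▸ pow_pos hpos s
      linarith
    · have h2 : (Fintype.card F : ℚ)⁻¹ ^ s = (Fintype.card F : ℚ)⁻¹ ^ 1 := by
        rw [pow_one]
        linarith [h.2.1]
      have : s = 1 := (pow_right_strictAnti₀ hpos hlt).injective h2
      subst this
      exact h.2.2
  -- The bias gives exactly |H|/q² zeros, and U has at least that many elements, so U is the whole
  -- zero set.
  have hzero : ∀ x : H, Q x = 0 → x ∈ U := by
    have hsub : Finset.univ.filter (fun x : H => x ∈ U) ⊆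
        Finset.univ.filter (fun x : H => (Q.comp H.subtype) x = 0) := fun x hx => by
      simp only [Finset.mem_filter, Finset.mem_univ, true_and] at hx ⊢
      exact hU0 x hx
    have hcard : (Finset.univ.filter (fun x : H => x ∈ U)).card =
        Fintype.card F ^ finrank F U := by
      rw [← card_eq_pow_finrank (K := F) (V := U), Fintype.card_subtype]
    have hle : (Finset.univ.filter (fun x : H => (Q.comp H.subtype) x = 0)).card ≤
        (Finset.univ.filter (fun x : H => x ∈ U)).card := by
      have h1 := card_zeros_of_bias hb
      rw [card_eq_pow_finrank (K := F) (V := H)] at h1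
      rw [hcard]
      have h2 : (Fintype.card F : ℚ) ^ finrank F H ≤
          (Fintype.card F : ℚ) ^ finrank F U * (Fintype.card F : ℚ) ^ 2 := by
        rw [← pow_add]
        exact pow_le_pow_right₀ hF.le hU
      push_cast at h1
      rw [← h1] at h2
      exact_mod_cast le_of_mul_le_mul_right h2 (by positivity)
    intro x hx
    have := Finset.eq_of_subset_of_card_le hsub hle
    have hx' : x ∈ Finset.univ.filter (fun x : H => (Q.comp H.subtype) x = 0) :=
      Finset.mem_filter.2 ⟨Finset.mem_univ _, hx⟩
    rw [← this] at hx'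
    simpa using hx'
  have hpolar : ∀ x ∈ U, ∀ y : H, QuadraticMap.polar Q (x : V) y = 0 := by
    intro x hx y
    by_contra hne
    have hx0 : Q x = 0 := hU0 x hx
    -- The coefficient is chosen so that Q vanishes at this vector.
    have hmem : y + (-(Q y) / QuadraticMap.polar Q (x : V) y) • x ∈ U := by
      refine hzero _ ?_
      rw [Submodule.coe_add, Submodule.coe_smul, apply_add_smul Q hx0]
      field_simp
      ring
    have hy : y ∈ U := (U.add_mem_iff_left (U.smul_mem _ hx)).1 hmem
    have h1 : Q (x + y : V) = 0 := hU0 _ (U.add_mem hx hy)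
    have h2 : Q y = 0 := hU0 y hy
    exact hne (by rw [QuadraticMap.polar, h1, hx0, h2]; simp)
  by_cases hrad : ∀ x ∈ U, ∀ v, QuadraticMap.polar Q (x : V) v = 0
  · exfalso
    apply hQ
    obtain ⟨W, hW⟩ := exists_isCompl (U.map H.subtype)
    have e := Submodule.finrank_add_eq_of_isCompl hW
    rw [Submodule.finrank_map_subtype_eq] at e
    refine VanishesInCodim.of_radical_compl hW ?_ ?_
      (vanishesInCodim_two_of_finrank_le _ (by omega))
    · rintro _ ⟨x, hx, rfl⟩
      exact hU0 x hx
    · rintro _ ⟨x, hx, rfl⟩ v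
      exact hrad x hx v
  · push Not at hrad
    obtain ⟨x, hx, v, hv⟩ := hrad
    refine bias_eq_restrict_of_polar Q H hr x (hU0 x hx) ?_
    have hle : H ≤ LinearMap.ker (QuadraticMap.polarBilin Q (x : V)) := fun y hy => by
      rw [LinearMap.mem_ker, QuadraticMap.polarBilin_apply_apply]
      exact hpolar x hx ⟨y, hy⟩
    have heq := Submodule.eq_of_le_of_finrank_le hle (by have := finrank_ker_polar hv; omega)
    intro y
    conv_lhs => rw [heq]
    rw [LinearMap.mem_ker, QuadraticMap.polarBilin_apply_apply]

end FormCode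

end

/-! ### Functions of low-dimensional restrictions and the design property -/

section

namespace FormCode

universe u

variable {F : Type*} {V : Type u} [Field F] [AddCommGroup V] [Module F V]

variable (F V) in
/-- The span of the functions of a quadratic form that depend only on its restriction to some
subspace of dimension at most `d`. -/
def lowDim (d : ℕ) : Submodule ℚ (QuadraticForm F V → ℚ) :=
  Submodule.span ℚ {Φ | ∃ U : Submodule F V, finrank F U ≤ d ∧
    ∀ Q Q' : QuadraticForm F V, (∀ u ∈ U, Q u = Q' u) → Φ Q = Φ Q'}

theorem lowDim_mono {a b : ℕ} (h : a ≤ b) : lowDim F V a ≤ lowDim F V b :=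
  Submodule.span_mono (fun _ ⟨U, h1, h2⟩ => ⟨U, h1.trans h, h2⟩)

/-- Functions that read a form on U and on U' have a product that reads it on U ⊔ U', so the
dimension behaves like a polynomial degree. -/
theorem mul_mem_lowDim [FiniteDimensional F V] {a b : ℕ} {Φ Ψ : QuadraticForm F V → ℚ}
    (hΦ : Φ ∈ lowDim F V a) (hΨ : Ψ ∈ lowDim F V b) : Φ * Ψ ∈ lowDim F V (a + b) := by
  have h := Submodule.mul_mem_mul hΦ hΨ
  rw [lowDim, lowDim, Submodule.span_mul_span] at h
  refine Submodule.span_mono ?_ h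
  rintro _ ⟨Φ, ⟨U, h1, h2⟩, Ψ, ⟨U', h1', h2'⟩, rfl⟩
  refine ⟨U ⊔ U', (Submodule.finrank_add_le_finrank_add_finrank U U').trans (by omega), ?_⟩
  intro Q Q' h
  simp only [Pi.mul_apply]
  rw [h2 Q Q' (fun u hu => h u (le_sup_left (a := U) hu)),
    h2' Q Q' (fun u hu => h u (le_sup_right (a := U) hu))]

theorem const_mem_lowDim (c : ℚ) (d : ℕ) :
    (fun _ : QuadraticForm F V => c) ∈ lowDim F V d :=
  Submodule.subset_span ⟨⊥, by simp, fun _ _ _ => rfl⟩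

theorem prod_mem_lowDim [FiniteDimensional F V] {ι : Type*} (s : Finset ι) {d : ℕ}
    (g : ι → QuadraticForm F V → ℚ) (hg : ∀ i ∈ s, g i ∈ lowDim F V d) :
    ∏ i ∈ s, g i ∈ lowDim F V (d * s.card) := by
  classical
  induction s using Finset.induction_on with
  | empty => exact const_mem_lowDim 1 _
  | insert a s ha ih =>
    rw [Finset.prod_insert ha, Finset.card_insert_of_notMem ha, mul_add, mul_one, add_comm]
    exact mul_mem_lowDim (hg a (Finset.mem_insert_self a s))
      (ih (fun i hi => hg i (Finset.mem_insert_of_mem hi)))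

theorem exists_submodule_ge_finrank_eq [FiniteDimensional F V] (k : ℕ) :
    ∀ U : Submodule F V, finrank F U + k ≤ finrank F V →
      ∃ U' : Submodule F V, U ≤ U' ∧ finrank F U' = finrank F U + k := by
  induction k with
  | zero => exact fun U _ => ⟨U, le_rfl, rfl⟩
  | succ k ih =>
    intro U hU
    obtain ⟨U', h1, h2⟩ := ih U (by omega)
    obtain ⟨v, hv⟩ : ∃ v, v ∉ U' := by
      by_contra! hall
      have : U' = ⊤ := eq_top_iff.2 (fun v _ => hall v)
      rw [this, finrank_top] at h2
      omega
    refine ⟨U' ⊔ F ∙ v, h1.trans le_sup_left, ?_⟩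
    rw [Submodule.finrank_sup_span_singleton hv, h2, add_assoc]

instance finite_quadraticForm [Finite F] [Finite V] : Finite (QuadraticForm F V) :=
  Finite.of_injective (fun Q : QuadraticForm F V => (Q : V → F)) DFunLike.coe_injective

theorem card_quadraticForm_le [Finite F] [Finite V] :
    Nat.card (QuadraticForm F V) ≤ Nat.card F ^ (finrank F V + 1).choose 2 := by
  classical
  have := Fintype.ofFinite F
  let b := finBasis F V
  let g : QuadraticForm F V → Sym2 (Fin (finrank F V)) → F :=
    -- The bilinear form is triangular in the basis, so one coefficient per unordered pair
    -- determines Q.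
    fun Q z => Q.toBilin b (b z.inf) (b z.sup)
  have hg : Function.Injective g := by
    intro Q Q' h
    rw [← QuadraticMap.toQuadraticMap_toBilin Q b, ← QuadraticMap.toQuadraticMap_toBilin Q' b]
    congr 1
    refine b.ext fun i => b.ext fun j => ?_
    rcases le_or_gt i j with hij | hij
    · have := congrFun h s(i, j)
      simpa only [g, Sym2.inf_mk, Sym2.sup_mk, inf_eq_left.2 hij, sup_eq_right.2 hij] using this
    · rw [QuadraticMap.toBilin_apply, QuadraticMap.toBilin_apply]
      simp [hij.ne', hij.not_gt]
  refine (Nat.card_le_card_of_injective g hg).trans ?_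
  simp [Nat.card_eq_fintype_card, Sym2.card]

/-- Restriction to a subspace of codimension two is injective on a set of forms
whose differences do not vanish in codimension two. -/
theorem restrict_injOn {C : Finset (QuadraticForm F V)} {U : Submodule F V}
    (hU : finrank F V ≤ finrank F U + 2)
    (hC : ∀ Q ∈ C, ∀ Q' ∈ C, Q ≠ Q' → ¬ VanishesInCodim (Q - Q') 2) :
    Set.InjOn (fun Q : QuadraticForm F V => Q.comp U.subtype) C := by
  intro Q hQ Q' hQ' h
  by_contra hne
  refine hC Q hQ Q' hQ' hne ⟨U, hU, fun u hu => ?_⟩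
  have := congrArg (fun S : QuadraticForm F U => S ⟨u, hu⟩) h
  simpa [sub_eq_zero] using this

variable [Fintype F]

/-- The bias is an average of functions that each read the form at one vector, hence on one line. -/
theorem bias_restrict_mem_lowDim [Finite V] (H : Submodule F V) :
    (fun Q : QuadraticForm F V => bias (Q.comp H.subtype)) ∈ lowDim F V 1 := by
  have := Fintype.ofFinite H
  have h : (fun Q : QuadraticForm F V => bias (Q.comp H.subtype)) =
      (Fintype.card H : ℚ)⁻¹ • ∑ v : H, fun Q : QuadraticForm F V => zeroWeight (Q (v : V)) := by
    funext Q
    rw [bias_eq, Pi.smul_apply, Finset.sum_apply, smul_eq_mul, div_eq_inv_mul]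
    rfl
  rw [h]
  refine Submodule.smul_mem _ _ (Submodule.sum_mem _ fun v _ => Submodule.subset_span ?_)
  refine ⟨F ∙ (v : V), finrank_span_le_card (R := F) ({(v : V)} : Set V) |>.trans (by simp), ?_⟩
  intro Q Q' h
  simp only [h v (Submodule.mem_span_singleton_self _)]

theorem bias_mem_lowDim [Finite V] : (bias : QuadraticForm F V → ℚ) ∈ lowDim F V 1 := by
  have := Fintype.ofFinite V
  have h : (bias : QuadraticForm F V → ℚ) =
      (Fintype.card V : ℚ)⁻¹ • ∑ v : V, fun Q : QuadraticForm F V => zeroWeight (Q v) := by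
    funext Q
    rw [bias_eq, Pi.smul_apply, Finset.sum_apply, smul_eq_mul, div_eq_inv_mul]
  rw [h]
  refine Submodule.smul_mem _ _ (Submodule.sum_mem _ fun v _ => Submodule.subset_span ?_)
  refine ⟨F ∙ v, finrank_span_le_card (R := F) ({v} : Set V) |>.trans (by simp), ?_⟩
  intro Q Q' h
  simp only [h v (Submodule.mem_span_singleton_self _)]

/-- A code meeting the anticode bound is a design: the average over its differences of a function
that only sees small subspaces equals the average over all quadratic forms. -/
theorem design [Finite V] [Fintype (QuadraticForm F V)] (C : Finset (QuadraticForm F V))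
    (hn : 2 ≤ finrank F V)
    (hcard : Fintype.card F ^ (finrank F V - 1).choose 2 ≤ C.card)
    (hC : ∀ Q ∈ C, ∀ Q' ∈ C, Q ≠ Q' → ¬ VanishesInCodim (Q - Q') 2)
    {Φ : QuadraticForm F V → ℚ} (hΦ : Φ ∈ lowDim F V (finrank F V - 2)) :
    Fintype.card (QuadraticForm F V) * ∑ Q ∈ C, ∑ Q' ∈ C, Φ (Q - Q') =
      (C.card : ℚ) ^ 2 * ∑ Q, Φ Q := by
  classical
  refine Submodule.span_induction (p := fun Φ _ =>
    Fintype.card (QuadraticForm F V) * ∑ Q ∈ C, ∑ Q' ∈ C, Φ (Q - Q') =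
      (C.card : ℚ) ^ 2 * ∑ Q, Φ Q) ?_ (by simp) ?_ ?_ hΦ
  · rintro Φ ⟨U₀, h1, h2⟩
    obtain ⟨U, hle, hU⟩ := exists_submodule_ge_finrank_eq (finrank F V - 2 - finrank F U₀) U₀
      (by omega)
    have := Fintype.ofFinite (QuadraticForm F U)
    obtain ⟨π, hπ⟩ := U.exists_isCompl
    -- Forms on U are extended to V through a projection; Φ does not see the choice.
    let φ : QuadraticForm F U → ℚ := fun S => Φ (S.comp (Submodule.projectionOnto U π hπ))
    have hφ : ∀ Q, Φ Q = φ (Q.comp U.subtype) := by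
      intro Q
      refine h2 _ _ fun u hu => ?_
      have := Submodule.projectionOnto_apply_left hπ ⟨u, hle hu⟩
      simp only [QuadraticMap.comp_apply, Submodule.subtype_apply] at this ⊢
      rw [this]
    have hinj := restrict_injOn (U := U) (by omega) hC
    -- The image has at least as many elements as there are forms on U, since `hcard` meets the
    -- exponent for dimension n - 2.
    have himg : C.image (fun Q : QuadraticForm F V => Q.comp U.subtype) = Finset.univ := by
      rw [← Finset.card_eq_iff_eq_univ, Finset.card_image_of_injOn hinj]
      refine le_antisymm ?_ ?_
      · rw [← Finset.card_image_of_injOn hinj]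
        exact Finset.card_le_univ _
      · have := card_quadraticForm_le (F := F) (V := U)
        rw [Nat.card_eq_fintype_card, Nat.card_eq_fintype_card] at this
        refine (this.trans (le_of_eq ?_)).trans hcard
        congr 2
        omega
    have key : ∀ R : QuadraticForm F V, ∑ Q' ∈ C, Φ (R - Q') = ∑ S, φ S := by
      intro R
      have e : ∀ Q', Φ (R - Q') = φ (R.comp U.subtype - Q'.comp U.subtype) := fun Q' => by
        rw [hφ]
        rfl
      rw [Finset.sum_congr rfl (fun Q' _ => e Q'),
        ← Finset.sum_image (f := fun S => φ (R.comp U.subtype - S)) hinj, himg]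
      exact Fintype.sum_equiv (Equiv.subLeft _) _ _ (fun S => rfl)
    -- `key` holds for every form R, so summing it over all R yields the average over the whole
    -- space.
    have key2 : (C.card : ℚ) * ∑ Q, Φ Q = Fintype.card (QuadraticForm F V) * ∑ S, φ S := by
      have e : ∑ R, ∑ Q' ∈ C, Φ (R - Q') = C.card * ∑ Q, Φ Q := by
        rw [Finset.sum_comm]
        have : ∀ Q' ∈ C, ∑ R, Φ (R - Q') = ∑ Q, Φ Q := fun Q' _ =>
          Fintype.sum_equiv (Equiv.subRight Q') _ _ (fun R => rfl)
        rw [Finset.sum_congr rfl this, Finset.sum_const, nsmul_eq_mul]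
      rw [← e, Finset.sum_congr rfl (fun R _ => key R), Finset.sum_const, nsmul_eq_mul,
        Finset.card_univ]
    rw [Finset.sum_congr rfl (fun R _ => key R), Finset.sum_const, nsmul_eq_mul]
    linear_combination -(C.card : ℚ) * key2
  · intro Φ Ψ _ _ h1 h2
    simp only [Pi.add_apply, Finset.sum_add_distrib, mul_add]
    rw [h1, h2]
  · intro c Φ _ h
    simp only [Pi.smul_apply, smul_eq_mul, ← Finset.mul_sum]
    linear_combination c * h

end FormCode

end

/-! ### Test functions in odd and even dimension -/

section

namespace FormCode

universe u

variable {F : Type*} {V : Type u} [Field F] [AddCommGroup V] [Module F V]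

theorem prod_sq_sub_mem_lowDim [FiniteDimensional F V] {Ψ : QuadraticForm F V → ℚ}
    (h : Ψ ∈ lowDim F V 1) (c : ℕ → ℚ) (s : Finset ℕ) :
    (fun Q => ∏ i ∈ s, (Ψ Q ^ 2 - c i)) ∈ lowDim F V (2 * s.card) := by
  have hm : ∀ i ∈ s, (fun Q => Ψ Q ^ 2 - c i) ∈ lowDim F V 2 := fun i _ => by
    have h1 : (fun Q => Ψ Q ^ 2) = Ψ * Ψ := funext fun Q => sq _
    have h2 : (fun Q => Ψ Q ^ 2) ∈ lowDim F V 2 := by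
      rw [h1]
      exact (mul_mem_lowDim h h :)
    exact Submodule.sub_mem _ h2 (const_mem_lowDim (c i) 2)
  have e : (fun Q => ∏ i ∈ s, (Ψ Q ^ 2 - c i)) = ∏ i ∈ s, fun Q => Ψ Q ^ 2 - c i := by
    funext Q
    rw [Finset.prod_apply]
  rw [e]
  exact prod_mem_lowDim s _ hm

variable [Fintype F]

/-- The product of two coordinates; in odd dimension it is where the test function is strictly
positive. -/
theorem exists_bias_eq_inv_card [Finite V] (hn : 2 ≤ finrank F V) :
    ∃ Q : QuadraticForm F V, bias Q = (Fintype.card F : ℚ)⁻¹ := by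
  let b := finBasis F V
  let i : Fin (finrank F V) := ⟨0, by omega⟩
  let j : Fin (finrank F V) := ⟨1, by omega⟩
  have hij : i ≠ j := by simp [i, j]
  let Q : QuadraticForm F V := QuadraticMap.linMulLin (b.coord i) (b.coord j)
  have hpol : ∀ v, QuadraticMap.polar Q (b i) v = b.coord j v := by
    intro v
    simp [QuadraticMap.polar, Q, hij.symm]
    ring
  have hQ : Q (b i) = 0 := by simp [Q, hij]
  have hne : QuadraticMap.polar Q (b i) (b j) ≠ 0 := by rw [hpol]; simp
  have hmem : ∀ v, v ∈ LinearMap.ker (QuadraticMap.polarBilin Q (b i)) ↔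
      QuadraticMap.polar Q (b i) v = 0 := fun v => by
    rw [LinearMap.mem_ker, QuadraticMap.polarBilin_apply_apply]
  refine ⟨Q, ?_⟩
  rw [bias_eq_restrict_of_polar Q _ (finrank_ker_polar hne) (b i) hQ hmem,
    bias_eq_of_forall_eq_zero, mul_one]
  rintro ⟨v, hv⟩
  rw [hmem, hpol] at hv
  simp only [QuadraticMap.comp_apply, Submodule.subtype_apply, Q, QuadraticMap.linMulLin_apply, hv,
    mul_zero]

open Classical in
/-- A value off a hyperplane is uniformly distributed given the restriction to the hyperplane. -/
theorem sum_mul_bias_sub [Finite V] [Fintype (QuadraticForm F V)] (H : Submodule F V)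
    (hH : finrank F H + 1 = finrank F V) (g : QuadraticForm F V → ℚ)
    (hg : ∀ Q Q' : QuadraticForm F V, (∀ v ∈ H, Q v = Q' v) → g Q = g Q') :
    ∑ Q, g Q * (bias Q - (Fintype.card F : ℚ)⁻¹ * bias (Q.comp H.subtype)) = 0 := by
  have := Fintype.ofFinite V
  have e : ∀ Q : QuadraticForm F V,
      g Q * (bias Q - (Fintype.card F : ℚ)⁻¹ * bias (Q.comp H.subtype)) =
        (∑ v, if v ∈ H then 0 else g Q * zeroWeight (Q v)) / Fintype.card V := by
    intro Q
    rw [bias_eq_restrict_add Q H hH, add_sub_cancel_left, mul_div_assoc', Finset.mul_sum]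
    simp only [mul_ite, mul_zero]
  rw [Finset.sum_congr rfl (fun Q _ => e Q), ← Finset.sum_div, Finset.sum_comm]
  rw [Finset.sum_eq_zero, zero_div]
  intro v _
  by_cases hv : v ∈ H
  · simp [hv]
  simp only [hv, if_false]
  -- Adding t • f² leaves the form on H, hence g, unchanged, while Q v runs once through the field.
  obtain ⟨f, hf, hle⟩ := Submodule.exists_le_ker_of_notMem hv
  refine sum_eq_zero_of_sum_translates (F := F) _ (QuadraticMap.linMulLin f f) (fun Q => ?_)
  have e2 : ∀ t : F, g (Q + t • QuadraticMap.linMulLin f f) = g Q := fun t =>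
    hg _ _ fun w hw => by simp [LinearMap.mem_ker.1 (hle hw)]
  simp only [e2, ← Finset.mul_sum]
  have := sum_zeroWeight_affine (Q v) (mul_self_ne_zero.2 hf)
  simp only [add_apply, smul_apply, QuadraticMap.linMulLin_apply,
    smul_eq_mul, this, mul_zero]

theorem sq_sub_prod_nonneg {r x : ℚ} {s m : ℕ} (hr : 0 ≤ r) (hr1 : r ≤ 1) (hs : s ≤ 3)
    (hx : x ^ 2 = (r ^ s) ^ 2) : 0 ≤ ∏ i ∈ Finset.Icc 3 m, (x ^ 2 - (r ^ i) ^ 2) := by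
  refine Finset.prod_nonneg fun i hi => ?_
  rw [hx, sub_nonneg]
  exact pow_le_pow_left₀ (pow_nonneg hr i)
    (pow_le_pow_of_le_one hr hr1 (hs.trans (Finset.mem_Icc.1 hi).1)) 2

theorem sq_sub_prod_eq_zero {r x : ℚ} {s k m : ℕ} (hs : s ∈ Finset.Icc k m)
    (hx : x ^ 2 = (r ^ s) ^ 2) : ∏ i ∈ Finset.Icc k m, (x ^ 2 - (r ^ i) ^ 2) = 0 :=
  Finset.prod_eq_zero hs (by rw [hx, sub_self])

theorem sq_sub_prod_pos {r x : ℚ} {s k m : ℕ} (hr : 0 < r) (hr1 : r < 1) (hs : s < k)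
    (hx : x = r ^ s) : 0 < ∏ i ∈ Finset.Icc k m, (x ^ 2 - (r ^ i) ^ 2) := by
  refine Finset.prod_pos fun i hi => ?_
  rw [hx, sub_pos]
  exact pow_lt_pow_left₀ (pow_lt_pow_right_of_lt_one₀ hr hr1
    (hs.trans_le (Finset.mem_Icc.1 hi).1)) (pow_nonneg hr.le i) two_ne_zero

theorem code_lt_of_odd [Finite V] (C : Finset (QuadraticForm F V)) (m : ℕ) (hm : 2 ≤ m)
    (hn : finrank F V = 2 * m + 1)
    (hC : ∀ Q ∈ C, ∀ Q' ∈ C, Q ≠ Q' → ¬ VanishesInCodim (Q - Q') 2) :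
    C.card < Fintype.card F ^ (finrank F V - 1).choose 2 := by
  classical
  by_contra! hcard
  have := Fintype.ofFinite (QuadraticForm F V)
  set r : ℚ := (Fintype.card F : ℚ)⁻¹ with hr
  have hr0 : 0 < r := inv_card_pos
  have hr1 : r < 1 := inv_card_lt_one
  -- The roots are 1 (the zero difference), 0, -r² and ±r^s for 3 ≤ s ≤ m; the degree is 3 + 2(m -
  -- 2) = n - 2. The remaining biases are r, r² and -r; at -r both x and x + r² are negative.
  let g : ℚ → ℚ := fun x =>
    (1 - x) * (x * (x + r ^ 2) * ∏ s ∈ Finset.Icc 3 m, (x ^ 2 - (r ^ s) ^ 2))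
  let Φ : QuadraticForm F V → ℚ := fun Q => g (bias Q)
  have hΦ : Φ ∈ lowDim F V (finrank F V - 2) := by
    have h1 : (bias : QuadraticForm F V → ℚ) ∈ lowDim F V 1 := bias_mem_lowDim
    have h2 : (fun Q : QuadraticForm F V => 1 - bias Q) ∈ lowDim F V 1 :=
      Submodule.sub_mem _ (const_mem_lowDim 1 1) h1
    have h3 : (fun Q : QuadraticForm F V => bias Q + r ^ 2) ∈ lowDim F V 1 :=
      Submodule.add_mem _ h1 (const_mem_lowDim (r ^ 2) 1)
    have h4 := prod_sq_sub_mem_lowDim h1 (fun s => (r ^ s) ^ 2) (Finset.Icc 3 m)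
    have h5 := mul_mem_lowDim h2 (mul_mem_lowDim (mul_mem_lowDim h1 h3) h4)
    refine lowDim_mono ?_ h5
    rw [Nat.card_Icc]
    omega
  have hsum0 : ∑ Q ∈ C, ∑ Q' ∈ C, Φ (Q - Q') = 0 := by
    refine Finset.sum_eq_zero fun Q hQ => Finset.sum_eq_zero fun Q' hQ' => ?_
    by_cases hne : Q = Q'
    · have : bias (Q - Q') = 1 := bias_eq_of_forall_eq_zero (by simp [hne])
      simp [Φ, g, this]
    · have hv := hC Q hQ Q' hQ' hne
      rcases biasClassified (Q - Q') with h | ⟨s, hs, h | h⟩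
      · simp [Φ, g, h]
      · have hs3 : s ∈ Finset.Icc 3 m := Finset.mem_Icc.2
          ⟨by by_contra hlt; exact hv (h.2.mono (by omega)), by omega⟩
        have hz := sq_sub_prod_eq_zero (r := r) (x := bias (Q - Q')) hs3 (by rw [h.1])
        simp only [Φ, g, hz, mul_zero]
      · have hs2 : 2 ≤ s := by by_contra hlt; exact hv (h.2.2.mono (by omega))
        rcases hs2.eq_or_lt with rfl | hs2
        · have : bias (Q - Q') + r ^ 2 = 0 := by rw [h.2.1]; ring
          simp only [Φ, g, this, mul_zero, zero_mul]
        · have hs3 : s ∈ Finset.Icc 3 m := Finset.mem_Icc.2 ⟨hs2, by omega⟩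
          have hz := sq_sub_prod_eq_zero (r := r) (x := bias (Q - Q')) hs3 (by rw [h.2.1, neg_sq])
          simp only [Φ, g, hz, mul_zero]
  have hnonneg : ∀ Q, 0 ≤ Φ Q := by
    intro Q
    rcases biasClassified Q with h | ⟨s, hs, h⟩
    · simp [Φ, g, h]
    have hsq : bias Q ^ 2 = (r ^ s) ^ 2 := by
      rcases h with h | h
      · rw [h.1]
      · rw [h.2.1, neg_sq]
    by_cases hs3 : s ∈ Finset.Icc 3 m
    · simp only [Φ, g, sq_sub_prod_eq_zero hs3 hsq, mul_zero, le_refl]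
    have hs3 : s ≤ 2 := by
      rw [Finset.mem_Icc] at hs3
      omega
    have hp := sq_sub_prod_nonneg (m := m) hr0.le hr1.le (by omega) hsq
    refine mul_nonneg ?_ (mul_nonneg ?_ hp)
    · rcases h with h | h
      · rw [h.1, sub_nonneg]
        exact pow_le_one₀ hr0.le hr1.le
      · rw [h.2.1, sub_neg_eq_add]
        exact add_nonneg zero_le_one (pow_nonneg hr0.le s)
    · rcases h with h | h
      · rw [h.1]
        positivity
      · rw [h.2.1]
        have : r ^ 2 ≤ r ^ s := pow_le_pow_of_le_one hr0.le hr1.le hs3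
        exact mul_nonneg_of_nonpos_of_nonpos (by linarith [pow_nonneg hr0.le s]) (by linarith)
  have hd := design C (by omega) hcard hC hΦ
  rw [hsum0, mul_zero] at hd
  have hCpos : (C.card : ℚ) ≠ 0 := by
    have : 0 < Fintype.card F ^ (finrank F V - 1).choose 2 := pow_pos Fintype.card_pos _
    exact_mod_cast (this.trans_le hcard).ne'
  have hz : ∑ Q, Φ Q = 0 := by
    rcases mul_eq_zero.1 hd.symm with h | h
    · exact absurd h (pow_ne_zero 2 hCpos)
    · exact h
  obtain ⟨Q, hQ⟩ := exists_bias_eq_inv_card (F := F) (V := V) (by omega)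
  have h0 := (Finset.sum_eq_zero_iff_of_nonneg (fun Q _ => hnonneg Q)).1 hz Q (Finset.mem_univ Q)
  have hpos : 0 < Φ Q := by
    have hp := sq_sub_prod_pos (k := 3) (m := m) (s := 1) hr0 hr1 (by omega)
      (show bias Q = r ^ 1 by rw [hQ, pow_one])
    refine mul_pos ?_ (mul_pos ?_ hp) <;> rw [hQ]
    · exact sub_pos.2 hr1
    · positivity
  exact hpos.ne' h0

theorem code_lt_of_even [Finite V] (C : Finset (QuadraticForm F V)) (m : ℕ) (hm : 2 ≤ m)
    (hn : finrank F V = 2 * m)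
    (hC : ∀ Q ∈ C, ∀ Q' ∈ C, Q ≠ Q' → ¬ VanishesInCodim (Q - Q') 2) :
    C.card < Fintype.card F ^ (finrank F V - 1).choose 2 := by
  classical
  by_contra! hcard
  have := Fintype.ofFinite (QuadraticForm F V)
  set r : ℚ := (Fintype.card F : ℚ)⁻¹ with hr
  have hr0 : 0 < r := inv_card_pos
  have hr1 : r < 1 := inv_card_lt_one
  obtain ⟨H, -, hH⟩ := exists_submodule_ge_finrank_eq (finrank F V - 1) (⊥ : Submodule F V)
    (by rw [finrank_bot]; omega)
  rw [finrank_bot, zero_add] at hH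
  have hH1 : finrank F H + 1 = finrank F V := by omega
  -- Degree 1 + 2(m - 2), plus one for the factor bias - r b, makes n - 2. The root -r can be spared
  -- because that factor vanishes there on differences.
  let p : ℚ → ℚ := fun x => x * ∏ s ∈ Finset.Icc 2 (m - 1), (x ^ 2 - (r ^ s) ^ 2)
  let b : QuadraticForm F V → ℚ := fun Q => bias (Q.comp H.subtype)
  let Φ : QuadraticForm F V → ℚ := fun Q => p (b Q) * (bias Q - r * b Q)
  have hΦ : Φ ∈ lowDim F V (finrank F V - 2) := by
    have h1 : (bias : QuadraticForm F V → ℚ) ∈ lowDim F V 1 := bias_mem_lowDim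
    have h2 : b ∈ lowDim F V 1 := bias_restrict_mem_lowDim H
    have h3 : (fun Q => bias Q - r * b Q) ∈ lowDim F V 1 :=
      Submodule.sub_mem _ h1 (Submodule.smul_mem _ r h2)
    have h4 := prod_sq_sub_mem_lowDim h2 (fun s => (r ^ s) ^ 2) (Finset.Icc 2 (m - 1))
    have h5 := mul_mem_lowDim (mul_mem_lowDim h2 h4) h3
    refine lowDim_mono ?_ h5
    rw [Nat.card_Icc]
    omega
  have hunif : ∑ Q, Φ Q = 0 := by
    refine sum_mul_bias_sub H hH1 (fun Q => p (b Q)) fun Q Q' h => ?_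
    have : Q.comp H.subtype = Q'.comp H.subtype := QuadraticMap.ext fun v => h v v.2
    simp only [b, this]
  have hdiff : ∀ Q ∈ C, ∀ Q' ∈ C, Q ≠ Q' → Φ (Q - Q') = 0 := by
    intro Q hQ Q' hQ' hne
    have hv := hC Q hQ Q' hQ' hne
    rcases biasClassified ((Q - Q').comp H.subtype) with h | ⟨s, hs, h | h⟩
    · simp [Φ, p, b, h]
    -- Codimension s in H is codimension s + 1 in V, which excludes s ≤ 1; the upper limit comes
    -- from 2s ≤ 2m - 1.
    · have hs2 : s ∈ Finset.Icc 2 (m - 1) := Finset.mem_Icc.2 ⟨by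
        by_contra hlt
        exact hv ((h.2.of_submodule hH1.ge).mono (by omega)), by omega⟩
      have hz := sq_sub_prod_eq_zero (r := r) (x := bias ((Q - Q').comp H.subtype))
        hs2 (by rw [h.1])
      simp only [Φ, p, b, hz, mul_zero, zero_mul]
    · rcases h.1.eq_or_lt with rfl | hs2
      · have hb := bias_eq_of_hyperplane hH1 (by rw [h.2.1, pow_one]) hv
        simp only [Φ, b, hb, sub_self, mul_zero, hr]
      · have hs2 : s ∈ Finset.Icc 2 (m - 1) := Finset.mem_Icc.2 ⟨hs2, by omega⟩
        have hz := sq_sub_prod_eq_zero (r := r) (x := bias ((Q - Q').comp H.subtype))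
          hs2 (by rw [h.2.1, neg_sq])
        simp only [Φ, p, b, hz, mul_zero, zero_mul]
  -- Only the diagonal pairs survive, and they contribute a positive total against the mean zero of
  -- `hunif`.
  have hΦ0 : 0 < Φ 0 := by
    have h1 : bias (0 : QuadraticForm F V) = 1 := bias_eq_of_forall_eq_zero (by simp)
    have h2 : b 0 = 1 := bias_eq_of_forall_eq_zero (by simp)
    have hp := sq_sub_prod_pos (x := 1) (k := 2) (m := m - 1) (s := 0) hr0 hr1 (by omega)
      (pow_zero r).symm
    simp only [Φ, p, h1, h2]
    exact mul_pos (mul_pos one_pos hp) (by linarith)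
  have hsum : ∑ Q ∈ C, ∑ Q' ∈ C, Φ (Q - Q') = C.card * Φ 0 := by
    have : ∀ Q ∈ C, ∑ Q' ∈ C, Φ (Q - Q') = Φ 0 := by
      intro Q hQ
      rw [Finset.sum_eq_single_of_mem Q hQ fun Q' hQ' hne => hdiff Q hQ Q' hQ' hne.symm, sub_self]
    rw [Finset.sum_congr rfl this, Finset.sum_const, nsmul_eq_mul]
  have hd := design C (by omega) hcard hC hΦ
  rw [hsum, hunif, mul_zero] at hd
  have hCpos : (0 : ℚ) < C.card := by
    have : 0 < Fintype.card F ^ (finrank F V - 1).choose 2 := pow_pos Fintype.card_pos _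
    exact_mod_cast this.trans_le hcard
  have hQpos : (0 : ℚ) < Fintype.card (QuadraticForm F V) := by exact_mod_cast Fintype.card_pos
  exact (mul_pos hQpos (mul_pos hCpos hΦ0)).ne' hd

theorem code_lt [Finite V] (C : Finset (QuadraticForm F V)) (hn : 3 ≤ finrank F V)
    (hC : ∀ Q ∈ C, ∀ Q' ∈ C, Q ≠ Q' → ¬ VanishesInCodim (Q - Q') 2) :
    C.card < Fintype.card F ^ (finrank F V - 1).choose 2 := by
  rcases hn.eq_or_lt with h3 | h4
  · have h1 : C.card ≤ 1 := Finset.card_le_one.2 fun Q hQ Q' hQ' => by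
      by_contra hne
      exact hC Q hQ Q' hQ' hne (vanishesInCodim_two_of_finrank_le _ h3.ge)
    refine h1.trans_lt ?_
    rw [← h3]
    simpa using Fintype.one_lt_card (α := F)
  · rcases Nat.even_or_odd' (finrank F V) with ⟨m, hm | hm⟩
    · exact code_lt_of_even C m (by omega) hm hC
    · exact code_lt_of_odd C m (by omega) hm hC

end FormCode

end

/-! ### From homogeneous polynomials to quadratic forms: weight and codimension -/

namespace FormCode

section Polynomials

variable {n : ℕ} {F : Type*} [Field F]

theorem linForm_mem (a : Fin n → F) :
    ∑ i, MvPolynomial.C (a i) * MvPolynomial.X i ∈ LinForms n F :=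
  Submodule.sum_mem _ fun i _ => MvPolynomial.isHomogeneous_C_mul_X (a i) i

theorem exists_linForm_eq {l : MvPolynomial (Fin n) F} (hl : l ∈ LinForms n F) :
    ∃ a : Fin n → F, l = ∑ i, MvPolynomial.C (a i) * MvPolynomial.X i := by
  rw [LinForms, MvPolynomial.homogeneousSubmodule_one_eq_span_X,
    Submodule.mem_span_range_iff_exists_fun] at hl
  obtain ⟨a, rfl⟩ := hl
  exact ⟨a, Finset.sum_congr rfl fun i _ => MvPolynomial.smul_eq_C_mul _ _⟩

theorem exists_coeff_eq (P : QuadForms n F) : ∃ b : Fin n → Fin n → F,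
    (P : MvPolynomial (Fin n) F) =
      ∑ i, ∑ j, MvPolynomial.C (b i j) * (MvPolynomial.X i * MvPolynomial.X j) := by
  obtain ⟨k, l, l', h⟩ := exists_isSumOfProducts P
  choose a ha using fun t => exists_linForm_eq (l t).2
  choose a' ha' using fun t => exists_linForm_eq (l' t).2
  refine ⟨fun i j => ∑ t, a t i * a' t j, ?_⟩
  simp only [h, ha, ha', map_sum, map_mul, Finset.sum_mul, Finset.mul_sum]
  rw [Finset.sum_comm]
  conv_rhs => rw [Finset.sum_comm]
  refine Finset.sum_congr rfl fun i _ => ?_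
  rw [Finset.sum_comm]
  exact Finset.sum_congr rfl fun j _ => Finset.sum_congr rfl fun t _ => by ring

theorem exists_quadraticForm_eq_eval (P : QuadForms n F) :
    ∃ Q : QuadraticForm F (Fin n → F),
      ∀ x, Q x = MvPolynomial.eval x (P : MvPolynomial (Fin n) F) := by
  obtain ⟨b, hb⟩ := exists_coeff_eq P
  refine ⟨∑ i, ∑ j, b i j • QuadraticMap.proj i j, fun x => ?_⟩
  simp [hb]

/-- The quadratic form on `Fⁿ` given by a homogeneous polynomial of degree two. -/
noncomputable def toForm (P : QuadForms n F) : QuadraticForm F (Fin n → F) :=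
  (exists_quadraticForm_eq_eval P).choose

theorem toForm_apply (P : QuadForms n F) (x : Fin n → F) :
    toForm P x = MvPolynomial.eval x (P : MvPolynomial (Fin n) F) :=
  (exists_quadraticForm_eq_eval P).choose_spec x

theorem toForm_sub (P P' : QuadForms n F) : toForm (P - P') = toForm P - toForm P' := by
  ext x
  simp [toForm_apply]

/-- The values at e_i and e_i + e_j determine the coefficients of a quadratic polynomial, so this
holds even over the field with two elements. -/
theorem eq_zero_of_toForm_eq_zero {P : QuadForms n F} (h : toForm P = 0) : P = 0 := by
  classical
  obtain ⟨b, hb⟩ := exists_coeff_eq P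
  have hev : ∀ x : Fin n → F, ∑ i, ∑ j, b i j * (x i * x j) = 0 := fun x => by
    have := toForm_apply P x
    rw [h, hb] at this
    simpa using this.symm
  have hdiag : ∀ i, b i i = 0 := fun i => by
    simpa [Pi.single_apply] using hev (Pi.single i 1)
  have hoff : ∀ i j, b i j + b j i = 0 := fun i j => by
    have := hev (Pi.single i 1 + Pi.single j 1)
    simp only [Pi.add_apply, Pi.single_apply, mul_add, Finset.sum_add_distrib,
      mul_ite, mul_one, mul_zero, Finset.sum_ite_eq', Finset.mem_univ, if_true, hdiag] at this
    simpa [hdiag, add_comm] using this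
  refine Subtype.ext ?_
  rw [hb, ← Finset.sum_product', Submodule.coe_zero]
  -- The terms at (i, j) and (j, i) cancel, and the diagonal terms vanish.
  refine Finset.sum_involution (fun x _ => (x.2, x.1)) ?_ ?_ (by simp) (by simp)
  · rintro ⟨i, j⟩ -
    rw [mul_comm (MvPolynomial.X j), ← add_mul, ← map_add, hoff, map_zero, zero_mul]
  · rintro ⟨i, j⟩ - hne heq
    simp only [Prod.mk.injEq] at heq
    rw [heq.1, hdiag, map_zero, zero_mul] at hne
    exact hne rfl

theorem toForm_injective : Function.Injective (toForm : QuadForms n F → _) := fun P P' h =>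
  sub_eq_zero.1 (eq_zero_of_toForm_eq_zero (by rw [toForm_sub, h, sub_self]))

theorem exists_linForm_eval (f : (Fin n → F) →ₗ[F] F) :
    ∃ l : LinForms n F, ∀ x, MvPolynomial.eval x (l : MvPolynomial (Fin n) F) = f x := by
  classical
  refine ⟨⟨_, linForm_mem fun i => f fun j => if i = j then 1 else 0⟩, fun x => ?_⟩
  rw [f.pi_apply_eq_sum_univ x]
  simp [mul_comm]

/-- A form vanishing on `U` is a sum of as many products of functionals as the codimension
of `U`. -/
theorem exists_sum_products {V : Type*} [AddCommGroup V] [Module F V] [FiniteDimensional F V]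
    {Q : QuadraticForm F V} {k : ℕ} (h : VanishesInCodim Q k) :
    ∃ d ≤ k, ∃ f g : Fin d → V →ₗ[F] F, ∀ v, Q v = ∑ i, f i v * g i v := by
  obtain ⟨U, hU, hU0⟩ := h
  obtain ⟨W, hW⟩ := U.exists_isCompl
  have e := Submodule.finrank_add_eq_of_isCompl hW
  let b := finBasis F W
  let B := Q.toBilin (finBasis F V)
  have hB : ∀ v, Q v = B v v := fun v => by
    rw [← LinearMap.BilinMap.toQuadraticMap_apply, QuadraticMap.toQuadraticMap_toBilin]
  let π := U.projectionOnto W hW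
  let ρ := W.projectionOnto U hW.symm
  -- Write v = u + w with u in U and w in W. As B u u = 0, Q v = B w v + B u w, and expanding w in a
  -- basis of W gives one product per basis vector.
  refine ⟨finrank F W, by omega, fun i => b.coord i ∘ₗ ρ,
    fun i => B (b i) + B.flip (b i) ∘ₗ U.subtype ∘ₗ π, fun v => ?_⟩
  have hv : v = (π v : V) + ρ v := (Submodule.projection_add_projection_eq_self hW v).symm
  have hρ : (ρ v : V) = ∑ i, b.coord i (ρ v) • (b i : V) := by
    have := congrArg W.subtype (b.sum_repr (ρ v))
    rw [map_sum] at this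
    simpa only [map_smul, Submodule.subtype_apply, Basis.coord_apply] using this.symm
  have h1 : Q v = B (ρ v) v + B (π v) (ρ v) := by
    have h0 : B (π v) (π v) = 0 := by rw [← hB, hU0 _ (π v).2]
    have hgen : ∀ u w : V, B u u = 0 → B (u + w) (u + w) = B w (u + w) + B u w := fun u w h => by
      simp only [map_add, LinearMap.add_apply, h]
      ring
    have := hgen _ (ρ v) h0
    rwa [← hv, ← hB] at this
  rw [h1]
  conv_lhs => rw [hρ]
  simp [mul_add, Finset.sum_add_distrib]

/-- The decomposition into products is first an identity of functions; injectivity of `toForm` makes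
it one of polynomials. -/
theorem formWeight_le_of_vanishesInCodim {P : QuadForms n F} {k : ℕ}
    (h : VanishesInCodim (toForm P) k) : formWeight P ≤ k := by
  obtain ⟨d, hd, f, g, hfg⟩ := exists_sum_products h
  choose l hl using fun i => exists_linForm_eval (f i)
  choose l' hl' using fun i => exists_linForm_eval (g i)
  refine le_trans (Nat.sInf_le ?_) hd
  have hmem : ∑ i, (l i : MvPolynomial (Fin n) F) * (l' i : MvPolynomial (Fin n) F) ∈
      QuadForms n F :=
    Submodule.sum_mem _ fun i _ => MvPolynomial.IsHomogeneous.mul (l i).2 (l' i).2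
  refine ⟨l, l', ?_⟩
  have : P = ⟨_, hmem⟩ := toForm_injective <| QuadraticMap.ext fun x => by
    rw [hfg, toForm_apply]
    simp [hl, hl']
  exact congrArg Subtype.val this

end Polynomials

end FormCode

theorem mainTheorem2 {F : Type*} [Field F] [Finite F] (n : ℕ) (hn : 3 ≤ n)
    (C : Set (QuadForms n F)) (hC : 3 ≤ minWeight C) :
    C.encard < ((Nat.card F ^ ((n - 1) * (n - 2) / 2) : ℕ) : ℕ∞) := by
  classical
  have := Fintype.ofFinite F
  have : Finite (QuadForms n F) := Finite.of_injective _ FormCode.toForm_injective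
  have hweight : ∀ Q ∈ C, ∀ Q' ∈ C, Q ≠ Q' → 3 ≤ formWeight (Q - Q') := by
    intro Q hQ Q' hQ' hne
    simp only [minWeight, le_iInf_iff] at hC
    exact_mod_cast hC Q hQ Q' hQ' hne
  let C' : Finset (QuadraticForm F (Fin n → F)) :=
    C.toFinite.toFinset.map ⟨FormCode.toForm, FormCode.toForm_injective⟩
  have hlt : C'.card < Fintype.card F ^ (Module.finrank F (Fin n → F) - 1).choose 2 := by
    refine FormCode.code_lt C' (by simpa using hn) ?_
    simp only [C', Finset.mem_map, Set.Finite.mem_toFinset, Function.Embedding.coeFn_mk]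
    rintro _ ⟨Q, hQ, rfl⟩ _ ⟨Q', hQ', rfl⟩ hne h
    rw [← FormCode.toForm_sub] at h
    have h1 := hweight Q hQ Q' hQ' fun h => hne (congrArg _ h)
    have h2 := FormCode.formWeight_le_of_vanishesInCodim h
    omega
  rw [C.toFinite.encard_eq_coe_toFinset_card]
  rw [Finset.card_map, Module.finrank_fin_fun, Nat.choose_two_right, Nat.sub_sub] at hlt
  rw [Nat.card_eq_fintype_card]
  exact_mod_cast hlt
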